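/- Setting. Let $\mathbb K$ be a Hardy field of germs at $+\infty$ of real functions of a parameter $t$ that are definable in a fixed polynomially bounded o-minimal structure (expanding the ordered field $\mathbb R$), such that $t^r\in\mathbb K$ for all $r\in\mathbb R$, with valuation $\operatorname{val} f=\lim_{t\to\infty}\log|f(t)|/\log t\in\mathbb T:=\mathbb R\cup\{-\infty\}$ (so $\operatorname{val}0=-\infty$). The set $\mathbb T$ carries the max-plus operations; $(A\odot x)_i=\max_j(a_{ij}+x_j)$. For $A\in\mathbb T^{d\times m}$: - $\operatorname{atconv}(A)=\{A\odot x : x\in\mathbb T^m,\ \max_j x_j=0\}$ is the affine tropical convex hull of the columns of $A$, and $\bar A\in\mathbb T^{(d+1)\times m}$ is $A$ with an identically zero row added on top. - A lift of $A$ is a matrix $\mathbf A=(\mathbf a_{ij})\in\mathbb K_{\ge0}^{d\times m}$ with $\operatorname{val}\mathbf a_{ij}=a_{ij}$ for all $i,j$; $\operatorname{vol}\mathbf A$ is the germ of $t\mapsto\operatorname{vol}_d\operatorname{conv}\mathbf A(t)$, the $d$-dimensional volume of the convex hull of the columns of $\mathbf A(t)$. Put $\operatorname{qvol}^+(A)=\sup\operatorname{val}\operatorname{vol}\mathbf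 A$ and $\operatorname{qvol}^-(A)=\inf\operatorname{val}\operatorname{vol}\mathbf A$, over all lifts $\mathbf A$ of $A$. If both agree, the common value is denoted $\operatorname{qvol}(A)$. - A matrix is tropically sign-generic if, in the optimal assignment problem associated with any of its maximal square submatrices, all optimal permutations have the same parity (permutations of weight $-\infty$ are infeasible and do not count as optimal). Proposition. Let $A\in\mathbb T^{d\times m}$ and $B\in\mathbb T^{d\times p}$. (1) Suppose that $\bar A$ is tropically sign-generic, or that $A$ is tropically sign-generic and $p\neq d$. If $\operatorname{atconv}(A)\subseteq\operatorname{atconv}(B)$, then $\operatorname{qvol}^+(A)\le\operatorname{qvol}^+(B)$. (2) In particular, if $\operatorname{atconv}(A)=\operatorname{atconv}(B)$ and $\bar A$, $\bar B$ are both tropically sign-generic, then $\operatorname{qvol}(A)$ and $\operatorname{qvol}(B)$ are defined (that is, $\operatorname{qvol}^+=\operatorname{qvol}^-\in\mathbb T$ for both matrices) and $\operatorname{qvol}(A)=\operatorname{qvol}(B)$. -/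

import Mathlib

open Filter Topology MeasureTheory

universe u v

namespace DequantizedVolume

/-! ### Tropical numbers, tropical products, affine tropical convex hulls -/

/-- The ground set `ℝ ∪ {-∞}` of the max-plus semiring. Tropical addition is the maximum `⊔`
(with neutral element `⊥ = -∞`), tropical multiplication is `+` (with `⊥` absorbing). -/
abbrev Trop : Type := WithBot ℝ

/-- The inclusion of `ℝ ∪ {-∞}` in `[-∞, +∞]`. -/
noncomputable def Trop.toEReal : Trop → EReal :=
  WithBot.recBotCoe ⊥ (fun r : ℝ => (r : EReal))

/-- The tropical matrix-vector product, `(A ⊙ x) i = max_j (A i j + x j)`. -/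
noncomputable def tmulVec {d m : ℕ} (A : Matrix (Fin d) (Fin m) Trop) (x : Fin m → Trop) :
    Fin d → Trop :=
  fun i => Finset.univ.sup fun j => A i j + x j

/-- The affine tropical convex hull of the columns of `A`: all `A ⊙ x` with `max_j x j = 0`. -/
def atconv {d m : ℕ} (A : Matrix (Fin d) (Fin m) Trop) : Set (Fin d → Trop) :=
  {y | ∃ x : Fin m → Trop, Finset.univ.sup x = 0 ∧ y = tmulVec A x}

/-- The matrix `Ā`, obtained by adding an identically zero row on top of `A`. -/
def bar {d m : ℕ} (A : Matrix (Fin d) (Fin m) Trop) : Matrix (Fin (d + 1)) (Fin m) Trop :=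
  Matrix.of (Fin.cons (fun _ => 0) A)

/-! ### Optimal assignments and sign-genericity -/

/-- The weight of a permutation in the assignment problem with weights `C`. -/
def weight {k : ℕ} (C : Matrix (Fin k) (Fin k) Trop) (σ : Equiv.Perm (Fin k)) : Trop :=
  ∑ i, C i (σ i)

/-- The tropical determinant: the value of the optimal assignment problem with weights `C`. -/
def tper {k : ℕ} (C : Matrix (Fin k) (Fin k) Trop) : Trop :=
  Finset.univ.sup (weight C)

/-- `σ` is an optimal solution of the assignment problem with weights `C`. An entry `-∞` is a
forbidden assignment, so a permutation of weight `-∞` is not a feasible solution. -/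
def IsOptimal {k : ℕ} (C : Matrix (Fin k) (Fin k) Trop) (σ : Equiv.Perm (Fin k)) : Prop :=
  weight C σ = tper C ∧ weight C σ ≠ ⊥

/-- Tropical sign-genericity: for every maximal square submatrix, all optimal permutations have
the same parity. -/
def SignGeneric {r m : ℕ} (A : Matrix (Fin r) (Fin m) Trop) : Prop :=
  ∀ (f : Fin (min r m) ↪o Fin r) (g : Fin (min r m) ↪o Fin m)
    (σ τ : Equiv.Perm (Fin (min r m))),
    IsOptimal (A.submatrix f g) σ → IsOptimal (A.submatrix f g) τ →
      Equiv.Perm.sign σ = Equiv.Perm.sign τ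

/-! ### Polynomially bounded o-minimal structures and Hardy fields -/

/-- The graph of `f : ℝ → ℝ` is definable, with real parameters, in the given structure. -/
def DefinableFunction (L : FirstOrder.Language.{u, v}) [L.Structure ℝ] (f : ℝ → ℝ) : Prop :=
  (Set.univ : Set ℝ).Definable₂ L {q : ℝ × ℝ | q.2 = f q.1}

/-- The given structure on `ℝ` is an o-minimal expansion of the ordered field of real numbers:
order, addition and multiplication are definable, and every definable subset of `ℝ` is a finite
union of (possibly degenerate or unbounded) intervals. -/
structure IsOMinimal (L : FirstOrder.Language.{u, v}) [L.Structure ℝ] : Prop where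
  definable_lt : (Set.univ : Set ℝ).Definable₂ L {q : ℝ × ℝ | q.1 < q.2}
  definable_add : (Set.univ : Set ℝ).Definable L {x : Fin 3 → ℝ | x 0 + x 1 = x 2}
  definable_mul : (Set.univ : Set ℝ).Definable L {x : Fin 3 → ℝ | x 0 * x 1 = x 2}
  tame : ∀ S : Set ℝ, (Set.univ : Set ℝ).Definable₁ L S →
    ∃ F : Set (Set ℝ), F.Finite ∧ (∀ I ∈ F, I.OrdConnected) ∧ S = ⋃₀ F

/-- Polynomial boundedness: every definable function `ℝ → ℝ` is eventually bounded by a power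
of the variable. -/
def IsPolynomiallyBounded (L : FirstOrder.Language.{u, v}) [L.Structure ℝ] : Prop :=
  ∀ f : ℝ → ℝ, DefinableFunction L f → ∃ N : ℕ, ∀ᶠ t in atTop, |f t| ≤ t ^ N

/-- The ring of germs at `+∞` of real functions. -/
abbrev RealGerm : Type := Germ (atTop : Filter ℝ) ℝ

/-- The germ at `+∞` of a function. -/
def germ (f : ℝ → ℝ) : RealGerm := (f : Germ (atTop : Filter ℝ) ℝ)

/-- A Hardy field: a ring of germs at `+∞` that is a field and is closed under
differentiation. -/
structure IsHardyField (K : Subring RealGerm) : Prop where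
  exists_inv : ∀ f ∈ K, f ≠ 0 → ∃ g ∈ K, f * g = 1
  closed_deriv : ∀ f : ℝ → ℝ, germ f ∈ K →
    (∀ᶠ t in atTop, DifferentiableAt ℝ f t) ∧ germ (deriv f) ∈ K

/-- `K` is a Hardy field of germs of functions definable in the given structure, and it
contains all real powers `t ^ r`. -/
structure IsBaseField (L : FirstOrder.Language.{u, v}) [L.Structure ℝ]
    (K : Subring RealGerm) : Prop where
  hardy : IsHardyField K
  definable : ∀ φ ∈ K, ∃ f : ℝ → ℝ, DefinableFunction L f ∧ φ = germ f
  rpow_mem : ∀ r : ℝ, germ (fun t => t ^ r) ∈ K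

/-! ### Valuation, lifts, and dequantized volumes -/

/-- `v` is the valuation of (the germ of) `f`, i.e. `v = lim_{t → ∞} log |f t| / log t`, where
`log 0 = -∞`. -/
def HasVal (f : ℝ → ℝ) (v : EReal) : Prop :=
  Tendsto (fun t : ℝ => ENNReal.log ‖f t‖ₑ / ((Real.log t : ℝ) : EReal)) atTop (𝓝 v)

/-- `a` (a matrix of functions representing a matrix of germs) is a lift of `A`: its entries are
nonnegative elements of `K`, with valuations the entries of `A`. -/
def IsLift (K : Subring RealGerm) {d m : ℕ} (A : Matrix (Fin d) (Fin m) Trop)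
    (a : Matrix (Fin d) (Fin m) (ℝ → ℝ)) : Prop :=
  ∀ i j, germ (a i j) ∈ K ∧ 0 ≤ germ (a i j) ∧ HasVal (a i j) (A i j).toEReal

/-- The volume of `conv a`, as a function of the parameter: its value at `t` is the Lebesgue
measure of the convex hull of the columns of the real matrix `a(t)`. -/
noncomputable def vol {d m : ℕ} (a : Matrix (Fin d) (Fin m) (ℝ → ℝ)) : ℝ → ℝ :=
  fun t => (volume (convexHull ℝ (Set.range fun (j : Fin m) (i : Fin d) => a i j t))).toReal

/-- The upper dequantized tropical volume: the supremum of `val (vol a)` over all lifts. -/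
noncomputable def qvolPlus (K : Subring RealGerm) {d m : ℕ}
    (A : Matrix (Fin d) (Fin m) Trop) : EReal :=
  sSup {v : EReal | ∃ a, IsLift K A a ∧ HasVal (vol a) v}

/-- The lower dequantized tropical volume: the infimum of `val (vol a)` over all lifts. -/
noncomputable def qvolMinus (K : Subring RealGerm) {d m : ℕ}
    (A : Matrix (Fin d) (Fin m) Trop) : EReal :=
  sInf {v : EReal | ∃ a, IsLift K A a ∧ HasVal (vol a) v}

/-- The dequantized tropical volume of `A` is defined and equal to `v`: the upper and the lower
dequantized tropical volumes have the common value `v`. -/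
def IsQvol (K : Subring RealGerm) {d m : ℕ} (A : Matrix (Fin d) (Fin m) Trop) (v : Trop) : Prop :=
  qvolPlus K A = v.toEReal ∧ qvolMinus K A = v.toEReal

end DequantizedVolume

/-! Everything reduces to one combinatorial number W(A), the best weight of an injective assignment
of the rows of `bar A` to columns (`maxAssignment`). Up to constants depending only on the format,
the volume of a polytope is the largest |det| of the maximal minors of its homogenized matrix. Each
Leibniz term of such a minor has valuation the weight of an assignment, so no lift exceeds W(A)
(`IsLift.valLE_vol`), and a monomial lift that favours one optimal assignment attains it
(`exists_isLift_hasVal_vol`). Hence qvol⁺(A) = W(A) always. If `bar A` is sign-generic, the dominant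
terms of an optimal minor share one sign and entries are nonnegative, so nothing cancels and every
lift has valuation W(A) (`IsLift.valGE_vol`).

Inclusion of hulls means A = B ⊙ X with X ≤ 0, the columns of X having maximum 0. In an optimal
assignment of A each entry is attained through some column f(i) of B. If f(i) = f(i'), swapping i
and i' gives an optimal assignment of opposite parity, against sign-genericity. So f is injective
and gives an assignment of B of at least the same weight (`SignGeneric.exists_embedding_le`). -/

namespace DequantizedVolume

/-! ### Assignments and sign-genericity -/

/-- The maximal weight of an assignment of the rows of `M` to pairwise distinct columns. -/
noncomputable def maxAssignment {r m : ℕ} (M : Matrix (Fin r) (Fin m) Trop) : Trop :=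
  (Finset.univ : Finset (Fin r ↪ Fin m)).sup fun g => ∑ i, M i (g i)

lemma sum_le_maxAssignment {r m : ℕ} (M : Matrix (Fin r) (Fin m) Trop) (g : Fin r ↪ Fin m) :
    ∑ i, M i (g i) ≤ maxAssignment M :=
  Finset.le_sup (f := fun g : Fin r ↪ Fin m => ∑ i, M i (g i)) (Finset.mem_univ g)

lemma exists_sum_eq_maxAssignment {r m : ℕ} (M : Matrix (Fin r) (Fin m) Trop)
    (h : maxAssignment M ≠ ⊥) : ∃ g : Fin r ↪ Fin m, ∑ i, M i (g i) = maxAssignment M := by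
  have hne : (Finset.univ : Finset (Fin r ↪ Fin m)).Nonempty := by
    rw [Finset.nonempty_iff_ne_empty]
    intro he
    exact h (by rw [maxAssignment, he, Finset.sup_empty])
  obtain ⟨g, -, hg⟩ := Finset.exists_mem_eq_sup _ hne fun g : Fin r ↪ Fin m => ∑ i, M i (g i)
  exact ⟨g, hg.symm⟩

/-- Sign-genericity speaks of increasing column choices, so an arbitrary injection is sorted first.
-/
lemma exists_orderEmbedding_comp_perm {r m : ℕ} (g : Fin r ↪ Fin m) :
    ∃ (o : Fin r ↪o Fin m) (σ : Equiv.Perm (Fin r)), ∀ i, g i = o (σ i) := by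
  classical
  have hc : (Finset.univ.map g).card = r := by simp
  let o := (Finset.univ.map g).orderEmbOfFin hc
  have hex : ∀ i, ∃ k, o k = g i := by
    intro i
    have : g i ∈ Set.range o := by
      rw [Finset.range_orderEmbOfFin]; simp
    exact this
  choose s hs using hex
  have hinj : Function.Injective s := by
    intro i j hij
    apply g.injective
    rw [← hs, ← hs, hij]
  exact ⟨o, Equiv.ofBijective s (Finite.injective_iff_bijective.mp hinj), fun i => (hs i).symm⟩

lemma SignGeneric.sign_eq {r m : ℕ} {M : Matrix (Fin r) (Fin m) Trop} (hM : SignGeneric M)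
    (o : Fin r ↪o Fin m) {σ τ : Equiv.Perm (Fin r)} (hσ : IsOptimal (M.submatrix id o) σ)
    (hτ : IsOptimal (M.submatrix id o) τ) : Equiv.Perm.sign σ = Equiv.Perm.sign τ := by
  have hrm : min r m = r := min_eq_left (by simpa using Fintype.card_le_of_embedding o.toEmbedding)
  unfold SignGeneric at hM
  rw [hrm] at hM
  exact hM (RelEmbedding.refl _) o σ τ hσ hτ

lemma exists_weight_eq_tper {k : ℕ} (C : Matrix (Fin k) (Fin k) Trop) :
    ∃ σ, weight C σ = tper C := by
  obtain ⟨g, -, hg⟩ := Finset.exists_mem_eq_sup _ Finset.univ_nonempty (weight C)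
  exact ⟨g, hg.symm⟩

lemma weight_le_tper {k : ℕ} (C : Matrix (Fin k) (Fin k) Trop) (σ : Equiv.Perm (Fin k)) :
    weight C σ ≤ tper C := Finset.le_sup (Finset.mem_univ σ)

/-- If `M = N ⊙ X` with `X` nonpositive and `M` is tropically sign-generic, then assignments
of `M` are dominated by assignments of `N`. -/
lemma SignGeneric.exists_embedding_le {r m p : ℕ} {M : Matrix (Fin r) (Fin m) Trop}
    (hM : SignGeneric M) (N : Matrix (Fin r) (Fin p) Trop) (X : Fin m → Fin p → Trop)
    (hX : ∀ j k, X j k ≤ 0) (hMN : ∀ i j, M i j = Finset.univ.sup fun k => N i k + X j k)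
    (g : Fin r ↪ Fin m) (hg : ∑ i, M i (g i) ≠ ⊥) :
    ∃ f : Fin r ↪ Fin p, ∑ i, M i (g i) ≤ ∑ i, N i (f i) := by
  obtain ⟨o, σ, hgo⟩ := exists_orderEmbedding_comp_perm g
  set C := M.submatrix id o with hC
  have hgw : ∑ i, M i (g i) = weight C σ := by simp [weight, hC, hgo]
  -- The given assignment need not be optimal; an optimal one on the same columns is at least as
  -- heavy, and sign-genericity applies to it.
  obtain ⟨τ, hτ⟩ := exists_weight_eq_tper C
  have hle : ∑ i, M i (g i) ≤ weight C τ := by rw [hgw, hτ]; exact weight_le_tper C σ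
  have hτb : weight C τ ≠ ⊥ := fun h => hg (le_bot_iff.mp (h ▸ hle))
  have hτo : IsOptimal C τ := ⟨hτ, hτb⟩
  have hatt : ∀ i, ∃ k, M i (o (τ i)) = N i k + X (o (τ i)) k := by
    intro i
    rcases (Finset.univ : Finset (Fin p)).eq_empty_or_nonempty with he | hne
    · exfalso
      apply hτb
      have : C i (τ i) = ⊥ := by
        change M i (o (τ i)) = ⊥
        rw [hMN, he, Finset.sup_empty]
      rw [weight, ← Finset.add_sum_erase _ _ (Finset.mem_univ i), this, WithBot.bot_add]
    · obtain ⟨k, -, hk⟩ := Finset.exists_mem_eq_sup _ hne fun k => N i k + X (o (τ i)) k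
      exact ⟨k, by rw [hMN, hk]⟩
  choose f hf using hatt
  have hwτ : weight C τ = ∑ i, N i (f i) + ∑ i, X (o (τ i)) (f i) := by
    rw [← Finset.sum_add_distrib]
    exact Finset.sum_congr rfl fun i _ => hf i
  have hinj : Function.Injective f := by
    intro i i' hii
    by_contra hne
    let s := Equiv.swap i i'
    have hfs : ∀ k, f (s k) = f k := by
      intro k
      simp only [s, Equiv.swap_apply_def]
      split_ifs with h1 h2
      · rw [h1, hii]
      · rw [h2, hii]
      · rfl
    -- Since f is invariant under s, the terms of X can be permuted by s without touching those of
    -- N; each resulting sum is a candidate in the maximum that defines the entry of M.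
    have hw : weight C τ ≤ weight C (τ * s) := by
      rw [hwτ, ← Equiv.sum_comp s fun i => X (o (τ i)) (f i), ← Finset.sum_add_distrib]
      refine Finset.sum_le_sum fun k _ => ?_
      change _ ≤ M k (o (τ (s k)))
      rw [hMN, hfs]
      exact Finset.le_sup (f := fun l => N k l + X (o (τ (s k))) l) (Finset.mem_univ (f k))
    have hw' : weight C (τ * s) = tper C := le_antisymm (weight_le_tper _ _) (hτ ▸ hw)
    have hsgn := hM.sign_eq o hτo ⟨hw', by rw [hw', ← hτ]; exact hτb⟩
    rw [Equiv.Perm.sign_mul, Equiv.Perm.sign_swap hne] at hsgn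
    rcases Int.units_eq_one_or (Equiv.Perm.sign τ) with h | h <;> simp [h] at hsgn
  refine ⟨⟨f, hinj⟩, hle.trans ?_⟩
  rw [hwτ]
  have h0 : ∑ i, X (o (τ i)) (f i) ≤ 0 := Finset.sum_nonpos fun i _ => hX _ _
  calc _ ≤ ∑ i, N i (f i) + 0 := by gcongr
    _ = _ := add_zero _

/-! ### Inclusion of hulls as a tropical factorization -/

@[simp] lemma bar_zero {d m : ℕ} (A : Matrix (Fin d) (Fin m) Trop) (j : Fin m) :
    bar A 0 j = 0 := rfl

@[simp] lemma bar_succ {d m : ℕ} (A : Matrix (Fin d) (Fin m) Trop) (i : Fin d) (j : Fin m) :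
    bar A i.succ j = A i j := rfl

lemma col_mem_atconv {d m : ℕ} (A : Matrix (Fin d) (Fin m) Trop) (j : Fin m) :
    (fun i => A i j) ∈ atconv A := by
  classical
  refine ⟨fun k => if k = j then 0 else ⊥, le_antisymm (Finset.sup_le fun k _ => ?_) ?_, ?_⟩
  · split_ifs <;> simp
  · simpa using Finset.le_sup (f := fun k => if k = j then (0 : Trop) else ⊥) (Finset.mem_univ j)
  · funext i
    rw [tmulVec]
    refine le_antisymm ?_ (Finset.sup_le fun k _ => ?_)
    · simpa using Finset.le_sup (f := fun k => A i k + if k = j then (0 : Trop) else ⊥)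
        (Finset.mem_univ j)
    · by_cases h : k = j <;> simp [h]

/-- Each column of A is a tropical affine combination of the columns of B. The normalization max = 0
of its coefficients both makes X nonpositive and reproduces the zero row. -/
lemma exists_factor_of_atconv_subset {d m p : ℕ} {A : Matrix (Fin d) (Fin m) Trop}
    {B : Matrix (Fin d) (Fin p) Trop} (h : atconv A ⊆ atconv B) :
    ∃ X : Fin m → Fin p → Trop, (∀ j k, X j k ≤ 0) ∧
      (∀ i j, A i j = Finset.univ.sup fun k => B i k + X j k) ∧
      ∀ i j, bar A i j = Finset.univ.sup fun k => bar B i k + X j k := by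
  choose X hX0 hX using fun j => h (col_mem_atconv A j)
  have hA : ∀ i j, A i j = Finset.univ.sup fun k => B i k + X j k := fun i j => congrFun (hX j) i
  refine ⟨X, fun j k => hX0 j ▸ Finset.le_sup (f := X j) (Finset.mem_univ k), hA, fun i j => ?_⟩
  refine Fin.cases ?_ (fun i => ?_) i
  · simp only [bar_zero, zero_add]
    exact (hX0 j).symm
  · exact hA i j

lemma sum_bar {d m : ℕ} (A : Matrix (Fin d) (Fin m) Trop) (g : Fin (d + 1) → Fin m) :
    ∑ i, bar A i (g i) = ∑ i, A i (g i.succ) := by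
  simp [Fin.sum_univ_succ]

theorem maxAssignment_bar_le {d m p : ℕ} {A : Matrix (Fin d) (Fin m) Trop}
    {B : Matrix (Fin d) (Fin p) Trop} (h : SignGeneric (bar A) ∨ (SignGeneric A ∧ p ≠ d))
    (hAB : atconv A ⊆ atconv B) : maxAssignment (bar A) ≤ maxAssignment (bar B) := by
  obtain ⟨X, hX, hA, hbar⟩ := exists_factor_of_atconv_subset hAB
  refine Finset.sup_le fun g _ => ?_
  by_cases hg : ∑ i, bar A i (g i) = ⊥
  · rw [hg]; exact bot_le
  rcases h with h | ⟨h, hpd⟩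
  · obtain ⟨f, hf⟩ := h.exists_embedding_le (bar B) X hX hbar g hg
    exact hf.trans (sum_le_maxAssignment _ f)
  · rw [sum_bar] at hg ⊢
    obtain ⟨f, hf⟩ := h.exists_embedding_le B X hX hA ((Fin.succEmb d).trans g) hg
    have hdp : d < p :=
      lt_of_le_of_ne (by simpa using Fintype.card_le_of_embedding f) (Ne.symm hpd)
    -- The assignment of B uses d columns; as p > d, a spare one takes the zero row at no cost.
    obtain ⟨k, hk⟩ : ∃ k, k ∉ Set.range f := by
      by_contra! hall
      have := Fintype.card_le_of_surjective f hall
      simp at this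
      omega
    have hinj : Function.Injective (Fin.cons k f : Fin (d + 1) → Fin p) :=
      Fin.cons_injective_iff.mpr ⟨hk, f.injective⟩
    refine hf.trans (le_of_eq_of_le ?_ (sum_le_maxAssignment _ ⟨_, hinj⟩))
    exact (sum_bar B (Fin.cons k f)).symm

/-! ### Calculus of valuations -/

@[simp] lemma Trop.toEReal_bot : Trop.toEReal ⊥ = ⊥ := rfl

@[simp] lemma Trop.toEReal_coe (r : ℝ) : Trop.toEReal (r : Trop) = (r : EReal) := rfl

lemma Trop.toEReal_lt_coe {u : Trop} {s : ℝ} : u.toEReal < (s : EReal) ↔ u < (s : Trop) := by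
  induction u using WithBot.recBotCoe with
  | bot => simp
  | coe r => simp

lemma Trop.coe_lt_toEReal {u : Trop} {s : ℝ} : (s : EReal) < u.toEReal ↔ (s : Trop) < u := by
  induction u using WithBot.recBotCoe with
  | bot => simp
  | coe r => simp

lemma Trop.toEReal_mono {u w : Trop} (h : u ≤ w) : u.toEReal ≤ w.toEReal := by
  by_contra! hlt
  obtain ⟨s, hs1, hs2⟩ := EReal.lt_iff_exists_real_btwn.mp hlt
  exact absurd h (not_le.mpr ((toEReal_lt_coe.mp hs1).trans (coe_lt_toEReal.mp hs2)))

/-- The valuation of `f` is at most `v`, in the sense of an upper limit. -/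
def ValLE (f : ℝ → ℝ) (v : EReal) : Prop :=
  ∀ s : ℝ, v < s → ∀ᶠ t in atTop, |f t| ≤ t ^ s

/-- The valuation of `f` is at least `v`, in the sense of a lower limit. -/
def ValGE (f : ℝ → ℝ) (v : EReal) : Prop :=
  ∀ s : ℝ, (s : EReal) < v → ∀ᶠ t in atTop, t ^ s ≤ |f t|

lemma log_enorm_div_le_iff {x t s : ℝ} (ht : 1 < t) :
    ENNReal.log ‖x‖ₑ / ((Real.log t : ℝ) : EReal) ≤ s ↔ |x| ≤ t ^ s := by
  have ht0 : 0 < t := by linarith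
  have hlog : (0 : EReal) < ((Real.log t : ℝ) : EReal) := by exact_mod_cast Real.log_pos ht
  have hp : 0 < t ^ s := Real.rpow_pos_of_pos ht0 s
  have : ((Real.log t : ℝ) : EReal) * s = ENNReal.log (ENNReal.ofReal (t ^ s)) := by
    rw [ENNReal.log_ofReal_of_pos hp, Real.log_rpow ht0, mul_comm]; norm_cast
  rw [EReal.div_le_iff_le_mul hlog (EReal.coe_ne_top _), this, ENNReal.log_le_log_iff,
    Real.enorm_eq_ofReal_abs, ENNReal.ofReal_le_ofReal_iff hp.le]

lemma le_log_enorm_div_iff {x t s : ℝ} (ht : 1 < t) :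
    (s : EReal) ≤ ENNReal.log ‖x‖ₑ / ((Real.log t : ℝ) : EReal) ↔ t ^ s ≤ |x| := by
  have ht0 : 0 < t := by linarith
  have hlog : (0 : EReal) < ((Real.log t : ℝ) : EReal) := by exact_mod_cast Real.log_pos ht
  have hp : 0 < t ^ s := Real.rpow_pos_of_pos ht0 s
  have : (s : EReal) * ((Real.log t : ℝ) : EReal) = ENNReal.log (ENNReal.ofReal (t ^ s)) := by
    rw [ENNReal.log_ofReal_of_pos hp, Real.log_rpow ht0]; norm_cast
  rw [EReal.le_div_iff_mul_le hlog (EReal.coe_ne_top _), this, ENNReal.log_le_log_iff,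
    Real.enorm_eq_ofReal_abs, ENNReal.ofReal_le_ofReal_iff (abs_nonneg _)]

/-- Comparison with real powers of t replaces the logarithmic limit, so the upper and lower bounds
can be handled separately and no limit has to exist beforehand. -/
theorem hasVal_iff {f : ℝ → ℝ} {v : EReal} : HasVal f v ↔ ValLE f v ∧ ValGE f v := by
  have ht : ∀ᶠ t : ℝ in atTop, 1 < t := eventually_gt_atTop 1
  rw [HasVal, tendsto_order]
  constructor
  · rintro ⟨h1, h2⟩
    refine ⟨fun s hs => ?_, fun s hs => ?_⟩
    · filter_upwards [h2 s hs, ht] with t h ht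
      exact (log_enorm_div_le_iff ht).mp h.le
    · filter_upwards [h1 s hs, ht] with t h ht
      exact (le_log_enorm_div_iff ht).mp h.le
  · rintro ⟨h1, h2⟩
    refine ⟨fun b hb => ?_, fun b hb => ?_⟩
    · obtain ⟨s, hs1, hs2⟩ := EReal.lt_iff_exists_real_btwn.mp hb
      filter_upwards [h2 s hs2, ht] with t h ht
      exact hs1.trans_le ((le_log_enorm_div_iff ht).mpr h)
    · obtain ⟨s, hs1, hs2⟩ := EReal.lt_iff_exists_real_btwn.mp hb
      filter_upwards [h1 s hs1, ht] with t h ht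
      exact ((log_enorm_div_le_iff ht).mpr h).trans_lt hs2

lemma ValGE.le_of_valLE {f : ℝ → ℝ} {v w : EReal} (h1 : ValGE f v) (h2 : ValLE f w) : v ≤ w := by
  by_contra! hlt
  obtain ⟨s, hs1, hs2⟩ := EReal.lt_iff_exists_real_btwn.mp hlt
  obtain ⟨s', hs1', hs2'⟩ := EReal.lt_iff_exists_real_btwn.mp hs1
  obtain ⟨t, ⟨h1, h2⟩, ht⟩ := (((h1 s hs2).and (h2 s' hs1')).and (eventually_gt_atTop 1)).exists
  have := (Real.rpow_lt_rpow_left_iff ht).mpr (EReal.coe_lt_coe_iff.mp hs2')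
  linarith

lemma ValLE.mono {f : ℝ → ℝ} {v w : EReal} (h : ValLE f v) (hvw : v ≤ w) : ValLE f w :=
  fun s hs => h s (hvw.trans_lt hs)

lemma ValLE.of_abs_le {f g : ℝ → ℝ} {v : EReal} (h : ValLE g v)
    (hfg : ∀ᶠ t in atTop, |f t| ≤ |g t|) : ValLE f v := fun s hs => by
  filter_upwards [h s hs, hfg] with t h1 h2 using h2.trans h1

lemma ValGE.of_le_abs {f g : ℝ → ℝ} {v : EReal} (h : ValGE g v)
    (hfg : ∀ᶠ t in atTop, |g t| ≤ |f t|) : ValGE f v := fun s hs => by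
  filter_upwards [h s hs, hfg] with t h1 h2 using h1.trans h2

lemma eventually_mul_rpow_le (c : ℝ) {s s' : ℝ} (h : s < s') :
    ∀ᶠ t : ℝ in atTop, c * t ^ s ≤ t ^ s' := by
  have hlim := (tendsto_rpow_atTop (sub_pos.mpr h)).eventually_ge_atTop c
  filter_upwards [hlim, eventually_gt_atTop 0] with t h1 h2
  calc c * t ^ s ≤ t ^ (s' - s) * t ^ s := by gcongr
    _ = t ^ s' := by rw [← Real.rpow_add h2]; ring_nf

lemma ValLE.const_mul {f : ℝ → ℝ} {v : EReal} (h : ValLE f v) (c : ℝ) :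
    ValLE (fun t => c * f t) v := fun s hs => by
  obtain ⟨s', hs1, hs2⟩ := EReal.lt_iff_exists_real_btwn.mp hs
  filter_upwards [h s' hs1, eventually_mul_rpow_le |c| (EReal.coe_lt_coe_iff.mp hs2)] with t h1 h2
  rw [abs_mul]
  exact (mul_le_mul_of_nonneg_left h1 (abs_nonneg c)).trans h2

lemma ValGE.const_mul {f : ℝ → ℝ} {v : EReal} (h : ValGE f v) {c : ℝ} (hc : c ≠ 0) :
    ValGE (fun t => c * f t) v := fun s hs => by
  obtain ⟨s', hs1, hs2⟩ := EReal.lt_iff_exists_real_btwn.mp hs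
  have hc' : 0 < |c| := abs_pos.mpr hc
  filter_upwards [h s' hs2, eventually_mul_rpow_le |c|⁻¹ (EReal.coe_lt_coe_iff.mp hs1)] with t h1 h2
  rw [abs_mul]
  rw [inv_mul_le_iff₀ hc'] at h2
  exact h2.trans (by gcongr)

lemma ValLE.sum {ι : Type*} {S : Finset ι} {f : ι → ℝ → ℝ} {v : EReal}
    (h : ∀ i ∈ S, ValLE (f i) v) : ValLE (fun t => ∑ i ∈ S, f i t) v := fun s hs => by
  obtain ⟨s', hs1, hs2⟩ := EReal.lt_iff_exists_real_btwn.mp hs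
  have hall : ∀ᶠ t in atTop, ∀ i ∈ S, |f i t| ≤ t ^ s' :=
    (Finset.eventually_all S).mpr fun i hi => h i hi s' hs1
  filter_upwards [hall, eventually_mul_rpow_le S.card (EReal.coe_lt_coe_iff.mp hs2)] with t h1 h2
  calc |∑ i ∈ S, f i t| ≤ ∑ i ∈ S, |f i t| := Finset.abs_sum_le_sum_abs _ _
    _ ≤ ∑ i ∈ S, t ^ s' := Finset.sum_le_sum h1
    _ ≤ t ^ s := by simpa using h2

lemma Trop.exists_add_le_of_add_lt {u w : Trop} {s : ℝ} (h : u + w < s) :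
    ∃ s₁ s₂ : ℝ, u < s₁ ∧ w < s₂ ∧ s₁ + s₂ = s := by
  induction u using WithBot.recBotCoe with
  | bot =>
    induction w using WithBot.recBotCoe with
    | bot => exact ⟨s, 0, by simp, by simp, by simp⟩
    | coe y => exact ⟨s - (y + 1), y + 1, by simp, by norm_cast; simp, by simp⟩
  | coe x =>
    induction w using WithBot.recBotCoe with
    | bot => exact ⟨x + 1, s - (x + 1), by norm_cast; simp, by simp, by simp⟩
    | coe y =>
      have h' : x + y < s := by exact_mod_cast h
      refine ⟨x + (s - x - y) / 2, y + (s - x - y) / 2, ?_, ?_, by ring⟩ <;>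
        exact WithBot.coe_lt_coe.mpr (by linarith)

lemma Trop.exists_le_add_of_lt_add {u w : Trop} {s : ℝ} (h : s < u + w) :
    ∃ s₁ s₂ : ℝ, s₁ < u ∧ s₂ < w ∧ s₁ + s₂ = s := by
  induction u using WithBot.recBotCoe with
  | bot => simp at h
  | coe x =>
    induction w using WithBot.recBotCoe with
    | bot => simp at h
    | coe y =>
      have h' : s < x + y := by exact_mod_cast h
      refine ⟨x + (s - x - y) / 2, y + (s - x - y) / 2, ?_, ?_, by ring⟩ <;>
        exact WithBot.coe_lt_coe.mpr (by linarith)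

lemma ValLE.mul {f g : ℝ → ℝ} {u w : Trop} (hf : ValLE f u.toEReal) (hg : ValLE g w.toEReal) :
    ValLE (fun t => f t * g t) (u + w).toEReal := fun s hs => by
  obtain ⟨s₁, s₂, h₁, h₂, rfl⟩ := Trop.exists_add_le_of_add_lt (Trop.toEReal_lt_coe.mp hs)
  filter_upwards [hf s₁ (Trop.toEReal_lt_coe.mpr h₁), hg s₂ (Trop.toEReal_lt_coe.mpr h₂),
    eventually_gt_atTop 0] with t h1 h2 ht
  rw [abs_mul, Real.rpow_add ht]
  gcongr

lemma ValGE.mul {f g : ℝ → ℝ} {u w : Trop} (hf : ValGE f u.toEReal) (hg : ValGE g w.toEReal) :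
    ValGE (fun t => f t * g t) (u + w).toEReal := fun s hs => by
  obtain ⟨s₁, s₂, h₁, h₂, rfl⟩ := Trop.exists_le_add_of_lt_add (Trop.coe_lt_toEReal.mp hs)
  filter_upwards [hf s₁ (Trop.coe_lt_toEReal.mpr h₁), hg s₂ (Trop.coe_lt_toEReal.mpr h₂),
    eventually_gt_atTop 0] with t h1 h2 ht
  rw [abs_mul, Real.rpow_add ht]
  gcongr

lemma hasVal_one : HasVal (fun _ => 1) (0 : Trop).toEReal := by
  rw [hasVal_iff]
  refine ⟨fun s hs => ?_, fun s hs => ?_⟩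
  · have : (0 : ℝ) ≤ s := (EReal.coe_lt_coe_iff.mp hs).le
    filter_upwards [eventually_ge_atTop 1] with t ht
    simpa using Real.one_le_rpow ht this
  · have : s ≤ 0 := (EReal.coe_lt_coe_iff.mp hs).le
    filter_upwards [eventually_ge_atTop 1] with t ht
    simpa using Real.rpow_le_one_of_one_le_of_nonpos ht this

lemma ValLE.prod {ι : Type*} (S : Finset ι) {f : ι → ℝ → ℝ} {u : ι → Trop}
    (h : ∀ i ∈ S, ValLE (f i) (u i).toEReal) :
    ValLE (fun t => ∏ i ∈ S, f i t) (∑ i ∈ S, u i).toEReal := by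
  classical
  induction S using Finset.induction_on with
  | empty => simpa using (hasVal_iff.mp hasVal_one).1
  | insert a S ha ih =>
    simp only [Finset.prod_insert ha, Finset.sum_insert ha]
    exact (h a (by simp)).mul (ih fun i hi => h i (by simp [hi]))

lemma ValGE.prod {ι : Type*} (S : Finset ι) {f : ι → ℝ → ℝ} {u : ι → Trop}
    (h : ∀ i ∈ S, ValGE (f i) (u i).toEReal) :
    ValGE (fun t => ∏ i ∈ S, f i t) (∑ i ∈ S, u i).toEReal := by
  classical
  induction S using Finset.induction_on with
  | empty => simpa using (hasVal_iff.mp hasVal_one).2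
  | insert a S ha ih =>
    simp only [Finset.prod_insert ha, Finset.sum_insert ha]
    exact (h a (by simp)).mul (ih fun i hi => h i (by simp [hi]))

/-- Subtracting a function of smaller valuation does not decrease the valuation. -/
lemma ValGE.of_sub_le_abs {f g h : ℝ → ℝ} {u w : Trop} (hg : ValGE g u.toEReal)
    (hh : ValLE h w.toEReal) (hwu : w < u)
    (hfg : ∀ᶠ t in atTop, |g t| - |h t| ≤ |f t|) : ValGE f u.toEReal := fun s hs => by
  have hmax : max (s : EReal) w.toEReal < u.toEReal := by
    refine max_lt hs ?_
    obtain ⟨r, rfl⟩ := WithBot.ne_bot_iff_exists.mp (ne_bot_of_gt hwu)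
    exact Trop.toEReal_lt_coe.mpr hwu
  -- With s < s₂ < s₁, eventually |g| - |h| ≥ t^s₁ - t^s₂ ≥ t^s₂ ≥ t^s, as 2 t^s₂ ≤ t^s₁.
  obtain ⟨s₁, h₁, h₁u⟩ := EReal.lt_iff_exists_real_btwn.mp hmax
  obtain ⟨s₂, h₂, h₂₁⟩ := EReal.lt_iff_exists_real_btwn.mp h₁
  have hs₂ : s < s₂ := EReal.coe_lt_coe_iff.mp ((le_max_left _ _).trans_lt h₂)
  filter_upwards [hg s₁ h₁u, hh s₂ ((le_max_right _ _).trans_lt h₂), hfg,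
    eventually_mul_rpow_le 2 (EReal.coe_lt_coe_iff.mp h₂₁), eventually_gt_atTop 1]
    with t k1 k2 k3 k4 k5
  have := (Real.rpow_lt_rpow_left_iff k5).mpr hs₂
  linarith

/-! ### Volumes of polytopes and maximal minors -/

/-- The matrix obtained by adding a row of ones on top of `P`. -/
def homogenize {d m : ℕ} (P : Matrix (Fin d) (Fin m) ℝ) : Matrix (Fin (d + 1)) (Fin m) ℝ :=
  Matrix.of (Fin.cons (fun _ => 1) P)

@[simp] lemma homogenize_zero {d m : ℕ} (P : Matrix (Fin d) (Fin m) ℝ) (j : Fin m) :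
    homogenize P 0 j = 1 := rfl

@[simp] lemma homogenize_succ {d m : ℕ} (P : Matrix (Fin d) (Fin m) ℝ) (i : Fin d) (j : Fin m) :
    homogenize P i.succ j = P i j := rfl

/-- The volume of the convex hull of the columns of a real matrix. -/
noncomputable def hullVolume {d m : ℕ} (P : Matrix (Fin d) (Fin m) ℝ) : ENNReal :=
  volume (convexHull ℝ (Set.range P.col))

/-- The vertices of the corner simplex: the origin and the standard basis vectors. -/
def cornerSimplex (d : ℕ) : Matrix (Fin d) (Fin (d + 1)) ℝ :=
  Matrix.of fun i => Fin.cons 0 (Pi.single i 1)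

lemma hullVolume_ne_top {d m : ℕ} (P : Matrix (Fin d) (Fin m) ℝ) : hullVolume P ≠ ⊤ :=
  ((Set.finite_range P.col).isCompact_convexHull ℝ).measure_lt_top.ne

/-- The corner simplex contains a small cube. Only positivity matters, since constants do not affect
valuations. -/
lemma hullVolume_cornerSimplex_pos (d : ℕ) : 0 < hullVolume (cornerSimplex d) := by
  have hsub : Set.Icc (0 : Fin d → ℝ) (fun _ => 1 / (d + 1)) ⊆
      convexHull ℝ (Set.range (cornerSimplex d).col) := by
    intro x hx
    have hsum : ∑ i, x i ≤ 1 := by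
      calc ∑ i, x i ≤ ∑ _i : Fin d, (1 / (d + 1) : ℝ) := Finset.sum_le_sum fun i _ => hx.2 i
        _ = d / (d + 1) := by simp; ring
        _ ≤ 1 := by rw [div_le_one (by positivity)]; linarith
    have hx' : x = ∑ j, (Fin.cons (1 - ∑ i, x i) x : Fin (d + 1) → ℝ) j •
        (cornerSimplex d).col j := by
      funext k
      simp [Fin.sum_univ_succ, cornerSimplex, Pi.single_apply]
    rw [hx']
    refine (convex_convexHull ℝ _).sum_mem (fun j _ => ?_) ?_ fun j _ =>
      subset_convexHull ℝ _ ⟨j, rfl⟩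
    · refine Fin.cases ?_ (fun i => ?_) j
      · simpa using hsum
      · simpa using hx.1 i
    · simp [Fin.sum_univ_succ]
  refine lt_of_lt_of_le ?_ (measure_mono hsub)
  rw [Real.volume_Icc_pi]
  refine pos_iff_ne_zero.mpr (Finset.prod_ne_zero_iff.mpr fun i _ => ?_)
  simp only [Pi.zero_apply, sub_zero, ne_eq, ENNReal.ofReal_eq_zero, not_le]
  positivity

/-- Subtract the first column from the others and expand along the top row, which becomes (1, 0, …,
0). -/
lemma det_homogenize {d : ℕ} (Q : Matrix (Fin d) (Fin (d + 1)) ℝ) :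
    (homogenize Q).det = (Matrix.of fun i j : Fin d => Q i j.succ - Q i 0).det := by
  let Q' : Matrix (Fin (d + 1)) (Fin (d + 1)) ℝ :=
    Matrix.of fun i => Fin.cons (homogenize Q i 0) fun j => homogenize Q i j.succ - homogenize Q i 0
  have h1 : (homogenize Q).transpose.det = Q'.transpose.det := by
    refine Matrix.det_eq_of_forall_row_eq_smul_add_const (Fin.cons 0 fun _ => 1) 0 rfl ?_
    intro i j
    refine Fin.cases ?_ (fun i => ?_) i
    · simp [Q']
    · simp [Q']
  rw [← Matrix.det_transpose, h1, Matrix.det_transpose, Matrix.det_succ_row_zero,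
    Fin.sum_univ_succ]
  have h0 : ∀ j : Fin d, Q' 0 j.succ = 0 := fun j => by simp [Q']
  have h00 : Q' 0 0 = 1 := by simp [Q']
  simp only [h0, h00]
  simp only [Fin.val_zero, pow_zero, mul_one, one_mul, mul_zero, zero_mul, Finset.sum_const_zero,
    add_zero]
  congr 1

open scoped Pointwise in
/-- The volume of a simplex, in units of the volume of the corner simplex. -/
theorem hullVolume_simplex {d : ℕ} (Q : Matrix (Fin d) (Fin (d + 1)) ℝ) :
    hullVolume Q = ENNReal.ofReal |(homogenize Q).det| * hullVolume (cornerSimplex d) := by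
  let L := Matrix.toLin' (Matrix.of fun i j : Fin d => Q i j.succ - Q i 0)
  -- The simplex is a translate of the image of the corner simplex under its edge matrix.
  have hrange : Set.range Q.col =
      Q.col 0 +ᵥ (L '' Set.range (cornerSimplex d).col) := by
    rw [← Set.range_comp, ← Set.image_vadd, ← Set.range_comp]
    congr 1
    funext j i
    refine Fin.cases ?_ (fun k => ?_) j
    · simp [L, cornerSimplex, Matrix.mulVec, dotProduct]
    · simp [L, cornerSimplex, Matrix.mulVec, dotProduct, Pi.single_apply]
  rw [hullVolume, hrange, convexHull_vadd, measure_vadd, ← LinearMap.image_convexHull,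
    Measure.addHaar_image_linearMap, LinearMap.det_toLin', det_homogenize, hullVolume]

lemma hullVolume_submatrix_le {d m n : ℕ} (P : Matrix (Fin d) (Fin m) ℝ) (g : Fin n → Fin m) :
    hullVolume (P.submatrix id g) ≤ hullVolume P := by
  refine measure_mono (convexHull_mono ?_)
  rintro _ ⟨j, rfl⟩
  exact ⟨g j, rfl⟩

/-- By Carathéodory's theorem, a polytope is the union of the simplices on its vertices. -/
lemma hullVolume_le_sum {d m : ℕ} (P : Matrix (Fin d) (Fin m) ℝ) :
    hullVolume P ≤ ∑ g : Fin (d + 1) → Fin m, hullVolume (P.submatrix id g) := by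
  have hsub : convexHull ℝ (Set.range P.col) ⊆
      ⋃ g ∈ (Finset.univ : Finset (Fin (d + 1) → Fin m)),
        convexHull ℝ (Set.range (P.submatrix id g).col) := by
    intro x hx
    rw [convexHull_eq_union] at hx
    simp only [Set.mem_iUnion] at hx
    obtain ⟨T, hT, hind, hxT⟩ := hx
    have hcard : T.card ≤ d + 1 := by
      have h1 := hind.card_le_finrank_succ
      have h2 := Submodule.finrank_le (vectorSpan ℝ (Set.range (Subtype.val : T → Fin d → ℝ)))
      rw [Module.finrank_fin_fun] at h2
      rw [Fintype.card_coe] at h1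
      omega
    have hne : T.Nonempty := by
      rw [Finset.nonempty_iff_ne_empty]
      rintro rfl
      simp at hxT
    have : Nonempty T := hne.to_subtype
    -- Smaller simplices are padded by repeating vertices, hence the sum over all maps g, injective
    -- or not.
    obtain ⟨e, he⟩ : ∃ e : Fin (d + 1) → T, Function.Surjective e := by
      obtain ⟨i⟩ := Function.Embedding.nonempty_of_card_le
        (α := T) (β := Fin (d + 1)) (by simpa using hcard)
      exact ⟨_, Function.invFun_surjective i.injective⟩
    have hex : ∀ y : T, ∃ j, P.col j = y := fun y => hT y.2
    choose c hc using hex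
    simp only [Set.mem_iUnion]
    refine ⟨fun k => c (e k), Finset.mem_univ _, convexHull_mono ?_ hxT⟩
    intro y hy
    obtain ⟨k, hk⟩ := he ⟨y, hy⟩
    exact ⟨k, (hc (e k)).trans (by rw [hk])⟩
  exact (measure_mono hsub).trans (measure_biUnion_finset_le _ _)

lemma abs_det_mul_le_hullVolume {d m : ℕ} (P : Matrix (Fin d) (Fin m) ℝ)
    (g : Fin (d + 1) → Fin m) :
    (hullVolume (cornerSimplex d)).toReal * |((homogenize P).submatrix id g).det| ≤
      (hullVolume P).toReal := by
  have h := ENNReal.toReal_mono (hullVolume_ne_top P) (hullVolume_submatrix_le P g)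
  rw [hullVolume_simplex, ENNReal.toReal_mul, ENNReal.toReal_ofReal (abs_nonneg _), mul_comm] at h
  convert h using 5
  ext i j
  refine Fin.cases ?_ (fun i => ?_) i <;> simp

lemma hullVolume_le_sum_abs_det {d m : ℕ} (P : Matrix (Fin d) (Fin m) ℝ) :
    (hullVolume P).toReal ≤ (hullVolume (cornerSimplex d)).toReal *
      ∑ g : Fin (d + 1) → Fin m, |((homogenize P).submatrix id g).det| := by
  have h := ENNReal.toReal_mono (ENNReal.sum_ne_top.mpr fun g _ => hullVolume_ne_top _)
    (hullVolume_le_sum P)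
  rw [ENNReal.toReal_sum fun g _ => hullVolume_ne_top _] at h
  refine h.trans_eq ?_
  rw [Finset.mul_sum]
  refine Finset.sum_congr rfl fun g _ => ?_
  rw [hullVolume_simplex, ENNReal.toReal_mul, ENNReal.toReal_ofReal (abs_nonneg _), mul_comm]
  congr 3
  ext i j
  refine Fin.cases ?_ (fun i => ?_) i <;> simp

/-! ### Bounds for the volume of a lift -/

lemma det_submatrix_eq_sum {r m : ℕ} (M : Matrix (Fin r) (Fin m) ℝ) (g : Fin r → Fin m) :
    (M.submatrix id g).det =
      ∑ σ : Equiv.Perm (Fin r), ((Equiv.Perm.sign σ : ℤ) : ℝ) * ∏ i, M i (g (σ i)) := by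
  rw [← Matrix.det_transpose, Matrix.det_apply']
  rfl

lemma abs_sign_mul {r : ℕ} (σ : Equiv.Perm (Fin r)) (x : ℝ) :
    |((Equiv.Perm.sign σ : ℤ) : ℝ) * x| = |x| := by
  rcases Int.units_eq_one_or (Equiv.Perm.sign σ) with h | h <;> simp [h]

/-- The value at `t` of a matrix of functions, with a row of ones added on top. -/
def homogenizeAt {d m : ℕ} (a : Matrix (Fin d) (Fin m) (ℝ → ℝ)) (t : ℝ) :
    Matrix (Fin (d + 1)) (Fin m) ℝ :=
  homogenize (Matrix.of fun i j => a i j t)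

lemma IsLift.hasVal_homogenizeAt {K : Subring RealGerm} {d m : ℕ}
    {A : Matrix (Fin d) (Fin m) Trop} {a : Matrix (Fin d) (Fin m) (ℝ → ℝ)} (ha : IsLift K A a)
    (i : Fin (d + 1)) (j : Fin m) :
    HasVal (fun t => homogenizeAt a t i j) (bar A i j).toEReal := by
  refine Fin.cases ?_ (fun i => ?_) i
  · exact hasVal_one
  · exact (ha i j).2.2

lemma IsLift.eventually_homogenizeAt_nonneg {K : Subring RealGerm} {d m : ℕ}
    {A : Matrix (Fin d) (Fin m) Trop} {a : Matrix (Fin d) (Fin m) (ℝ → ℝ)} (ha : IsLift K A a) :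
    ∀ᶠ t in atTop, ∀ i j, 0 ≤ homogenizeAt a t i j := by
  have h : ∀ᶠ t in atTop, ∀ i j, 0 ≤ a i j t :=
    eventually_all.mpr fun i => eventually_all.mpr fun j => Germ.coe_le.mp (ha i j).2.1
  filter_upwards [h] with t ht i j
  refine Fin.cases ?_ (fun i => ?_) i
  · exact zero_le_one
  · exact ht i j

/-- The valuation of the volume of a lift is at most the optimal assignment value. -/
theorem IsLift.valLE_vol {K : Subring RealGerm} {d m : ℕ}
    {A : Matrix (Fin d) (Fin m) Trop} {a : Matrix (Fin d) (Fin m) (ℝ → ℝ)} (ha : IsLift K A a) :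
    ValLE (vol a) (maxAssignment (bar A)).toEReal := by
  have hdet : ∀ g : Fin (d + 1) → Fin m,
      ValLE (fun t => |((homogenizeAt a t).submatrix id g).det|)
        (maxAssignment (bar A)).toEReal := by
    intro g
    by_cases hg : Function.Injective g
    · have hs : ValLE (fun t => ∑ σ : Equiv.Perm (Fin (d + 1)),
          ((Equiv.Perm.sign σ : ℤ) : ℝ) * ∏ i, homogenizeAt a t i (g (σ i)))
          (maxAssignment (bar A)).toEReal := by
        refine ValLE.sum fun σ _ => ValLE.const_mul ?_ _
        refine (ValLE.prod Finset.univ fun i _ =>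
          (hasVal_iff.mp (ha.hasVal_homogenizeAt i (g (σ i)))).1).mono (Trop.toEReal_mono ?_)
        exact sum_le_maxAssignment _ (σ.toEmbedding.trans ⟨g, hg⟩)
      refine hs.of_abs_le (Eventually.of_forall fun t => ?_)
      rw [abs_abs, det_submatrix_eq_sum]
    · obtain ⟨i, j, hij, hne⟩ := Function.not_injective_iff.mp hg
      intro s _
      filter_upwards [eventually_gt_atTop 0] with t ht
      rw [Matrix.det_zero_of_column_eq hne fun k => by simp [hij]]
      simpa using (Real.rpow_pos_of_pos ht s).le
  refine ((ValLE.sum fun g (_ : g ∈ Finset.univ) => hdet g).const_mul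
    (hullVolume (cornerSimplex d)).toReal).of_abs_le (Eventually.of_forall fun t => ?_)
  exact abs_le_abs_of_nonneg ENNReal.toReal_nonneg (hullVolume_le_sum_abs_det _)

lemma valGE_vol_of_det {d m : ℕ} {a : Matrix (Fin d) (Fin m) (ℝ → ℝ)} {v : EReal}
    (g : Fin (d + 1) → Fin m)
    (h : ValGE (fun t => ((homogenizeAt a t).submatrix id g).det) v) : ValGE (vol a) v := by
  have hκ : 0 < (hullVolume (cornerSimplex d)).toReal :=
    ENNReal.toReal_pos (hullVolume_cornerSimplex_pos d).ne' (hullVolume_ne_top _)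
  refine (h.const_mul hκ.ne').of_le_abs (Eventually.of_forall fun t => ?_)
  rw [abs_mul, abs_of_pos hκ]
  exact (abs_det_mul_le_hullVolume _ g).trans (le_abs_self _)

/-- In the sign-generic case no cancellation occurs in the determinants of a lift. -/
theorem IsLift.valGE_vol {K : Subring RealGerm} {d m : ℕ}
    {A : Matrix (Fin d) (Fin m) Trop} {a : Matrix (Fin d) (Fin m) (ℝ → ℝ)} (ha : IsLift K A a)
    (hA : SignGeneric (bar A)) : ValGE (vol a) (maxAssignment (bar A)).toEReal := by
  classical
  set W := maxAssignment (bar A) with hW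
  by_cases hWb : W = ⊥
  · intro s hs
    rw [hWb] at hs
    simp at hs
  obtain ⟨g, hg⟩ := exists_sum_eq_maxAssignment _ hWb
  obtain ⟨o, σ, hgo⟩ := exists_orderEmbedding_comp_perm g
  set C := (bar A).submatrix id o with hC
  have hle : ∀ τ, weight C τ ≤ W := fun τ =>
    sum_le_maxAssignment (bar A) (τ.toEmbedding.trans o.toEmbedding)
  have hσ : weight C σ = W := by rw [hW, ← hg]; simp [weight, hC, hgo]
  have htper : tper C = W := le_antisymm (Finset.sup_le fun τ _ => hle τ) (hσ ▸ weight_le_tper C σ)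
  have hopt : ∀ τ, weight C τ = W → IsOptimal C τ := fun τ h => ⟨h.trans htper.symm, h ▸ hWb⟩
  let Q : ℝ → Equiv.Perm (Fin (d + 1)) → ℝ := fun t τ => ∏ i, homogenizeAt a t i (o (τ i))
  -- S collects the optimal permutations; by finiteness the others stay below W by a definite gap,
  -- so their total is negligible.
  let S : Finset (Equiv.Perm (Fin (d + 1))) := Finset.univ.filter fun τ => weight C τ = W
  have hQ : ∀ τ, ValLE (fun t => Q t τ) (weight C τ).toEReal := fun τ =>
    ValLE.prod Finset.univ fun i _ => (hasVal_iff.mp (ha.hasVal_homogenizeAt i _)).1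
  have hQσ : ValGE (fun t => Q t σ) W.toEReal := by
    rw [← hσ]
    exact ValGE.prod Finset.univ fun i _ => (hasVal_iff.mp (ha.hasVal_homogenizeAt i _)).2
  have hrest : ValLE (fun t => ∑ τ ∈ Sᶜ, ((Equiv.Perm.sign τ : ℤ) : ℝ) * Q t τ)
      (Sᶜ.sup (weight C)).toEReal :=
    ValLE.sum fun τ hτ => ((hQ τ).mono (Trop.toEReal_mono (Finset.le_sup hτ))).const_mul _
  have hlt : Sᶜ.sup (weight C) < W := by
    rw [Finset.sup_lt_iff (bot_lt_iff_ne_bot.mpr hWb)]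
    intro τ hτ
    exact lt_of_le_of_ne (hle τ) (by simpa [S] using hτ)
  refine valGE_vol_of_det o (hQσ.of_sub_le_abs hrest hlt ?_)
  filter_upwards [ha.eventually_homogenizeAt_nonneg] with t ht
  -- Nonnegative products with a common sign add up in absolute value, so the optimal part is at
  -- least the single term of σ.
  have hQ0 : ∀ τ, 0 ≤ Q t τ := fun τ => Finset.prod_nonneg fun i _ => ht _ _
  have hS : ∑ τ ∈ S, ((Equiv.Perm.sign τ : ℤ) : ℝ) * Q t τ =
      ((Equiv.Perm.sign σ : ℤ) : ℝ) * ∑ τ ∈ S, Q t τ := by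
    rw [Finset.mul_sum]
    refine Finset.sum_congr rfl fun τ hτ => ?_
    rw [hA.sign_eq o (hopt τ (Finset.mem_filter.mp hτ).2) (hopt σ hσ)]
  have hσS : Q t σ ≤ ∑ τ ∈ S, Q t τ :=
    Finset.single_le_sum (fun τ _ => hQ0 τ) (by simp [S, hσ])
  have hdet : ((homogenizeAt a t).submatrix id o).det =
      ∑ τ ∈ S, ((Equiv.Perm.sign τ : ℤ) : ℝ) * Q t τ +
        ∑ τ ∈ Sᶜ, ((Equiv.Perm.sign τ : ℤ) : ℝ) * Q t τ := by
    rw [det_submatrix_eq_sum, Finset.sum_add_sum_compl]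
  have habs : |∑ τ ∈ S, ((Equiv.Perm.sign τ : ℤ) : ℝ) * Q t τ| = ∑ τ ∈ S, Q t τ := by
    rw [hS, abs_sign_mul, abs_of_nonneg (Finset.sum_nonneg fun τ _ => hQ0 τ)]
  have htri := abs_sub_abs_le_abs_add (∑ τ ∈ S, ((Equiv.Perm.sign τ : ℤ) : ℝ) * Q t τ)
    (∑ τ ∈ Sᶜ, ((Equiv.Perm.sign τ : ℤ) : ℝ) * Q t τ)
  rw [habs, ← hdet] at htri
  rw [abs_of_nonneg (hQ0 σ)]
  linarith

/-! ### Monomial lifts attaining the optimum -/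

/-- The function `t ↦ t ^ u`, where `t ^ (-∞) = 0`. -/
noncomputable def tropPow (u : Trop) : ℝ → ℝ :=
  WithBot.recBotCoe (fun _ => 0) (fun (r : ℝ) t => t ^ r) u

@[simp] lemma tropPow_bot (t : ℝ) : tropPow ⊥ t = 0 := rfl

@[simp] lemma tropPow_coe (r t : ℝ) : tropPow (r : Trop) t = t ^ r := rfl

@[simp] lemma tropPow_zero (t : ℝ) : tropPow 0 t = 1 := Real.rpow_zero t

lemma tropPow_nonneg (u : Trop) {t : ℝ} (ht : 0 < t) : 0 ≤ tropPow u t := by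
  induction u using WithBot.recBotCoe with
  | bot => simp
  | coe r => exact (Real.rpow_pos_of_pos ht r).le

lemma tropPow_add (u w : Trop) {t : ℝ} (ht : 0 < t) :
    tropPow (u + w) t = tropPow u t * tropPow w t := by
  induction u using WithBot.recBotCoe with
  | bot => simp
  | coe r =>
    induction w using WithBot.recBotCoe with
    | bot => simp
    | coe q => rw [← WithBot.coe_add]; exact Real.rpow_add ht r q

lemma tropPow_sum {ι : Type*} (S : Finset ι) (u : ι → Trop) {t : ℝ} (ht : 0 < t) :
    tropPow (∑ i ∈ S, u i) t = ∏ i ∈ S, tropPow (u i) t := by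
  classical
  induction S using Finset.induction_on with
  | empty => simp
  | insert a S ha ih => rw [Finset.sum_insert ha, Finset.prod_insert ha, tropPow_add _ _ ht, ih]

lemma tropPow_le {u w : Trop} (h : u ≤ w) {t : ℝ} (ht : 1 ≤ t) : tropPow u t ≤ tropPow w t := by
  induction u using WithBot.recBotCoe with
  | bot => exact tropPow_nonneg w (by linarith)
  | coe r =>
    induction w using WithBot.recBotCoe with
    | bot => simp at h
    | coe q => exact Real.rpow_le_rpow_of_exponent_le ht (WithBot.coe_le_coe.mp h)

lemma hasVal_tropPow (u : Trop) : HasVal (tropPow u) u.toEReal := by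
  rw [hasVal_iff]
  induction u using WithBot.recBotCoe with
  | bot =>
    refine ⟨fun s _ => ?_, fun s hs => by simp at hs⟩
    filter_upwards [eventually_gt_atTop 0] with t ht
    simpa using (Real.rpow_pos_of_pos ht s).le
  | coe r =>
    refine ⟨fun s hs => ?_, fun s hs => ?_⟩ <;>
    · have hrs := EReal.coe_lt_coe_iff.mp hs
      filter_upwards [eventually_ge_atTop 1] with t ht
      rw [tropPow_coe, abs_of_nonneg (Real.rpow_nonneg (by linarith) _)]
      exact Real.rpow_le_rpow_of_exponent_le ht hrs.le

/-- The lift of `A` by monomials with the positive integer coefficients `c`. -/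
noncomputable def monomialLift {d m : ℕ} (A : Matrix (Fin d) (Fin m) Trop)
    (c : Fin d → Fin m → ℕ) : Matrix (Fin d) (Fin m) (ℝ → ℝ) :=
  Matrix.of fun i j t => (c i j : ℝ) * tropPow (A i j) t

lemma isLift_monomialLift {K : Subring RealGerm} (hK : ∀ r : ℝ, germ (fun t => t ^ r) ∈ K)
    {d m : ℕ} (A : Matrix (Fin d) (Fin m) Trop) {c : Fin d → Fin m → ℕ} (hc : ∀ i j, c i j ≠ 0) :
    IsLift K A (monomialLift A c) := by
  intro i j
  refine ⟨?_, ?_, ?_⟩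
  · have hmul : germ (monomialLift A c i j) = (c i j : RealGerm) * germ (tropPow (A i j)) := rfl
    rw [hmul]
    -- Integer coefficients lie in every subring, so real constants in K are not needed.
    refine K.mul_mem (natCast_mem K _) ?_
    induction A i j using WithBot.recBotCoe with
    | bot => exact K.zero_mem
    | coe r => exact hK r
  · refine Germ.coe_le.mpr ?_
    filter_upwards [eventually_gt_atTop 0] with t ht
    exact mul_nonneg (Nat.cast_nonneg _) (tropPow_nonneg _ ht)
  · have h := hasVal_iff.mp (hasVal_tropPow (A i j))
    exact hasVal_iff.mpr ⟨h.1.const_mul _, h.2.const_mul (Nat.cast_ne_zero.mpr (hc i j))⟩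

lemma prod_homogenizeAt_monomialLift {d m : ℕ} (A : Matrix (Fin d) (Fin m) Trop)
    (c : Fin d → Fin m → ℕ) (g : Fin (d + 1) → Fin m) {t : ℝ} (ht : 0 < t) :
    ∏ i, homogenizeAt (monomialLift A c) t i (g i) =
      (∏ i : Fin d, (c i (g i.succ) : ℝ)) * tropPow (∑ i, bar A i (g i)) t := by
  rw [tropPow_sum _ _ ht, Fin.prod_univ_succ, Fin.prod_univ_succ]
  simp [homogenizeAt, monomialLift, Finset.prod_mul_distrib]

/-- Some lift of `A` attains the optimal assignment value: a large coefficient on the entries of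
an optimal assignment prevents cancellation in the corresponding determinant. -/
theorem exists_isLift_hasVal_vol {K : Subring RealGerm} (hK : ∀ r : ℝ, germ (fun t => t ^ r) ∈ K)
    {d m : ℕ} (A : Matrix (Fin d) (Fin m) Trop) :
    ∃ a, IsLift K A a ∧ HasVal (vol a) (maxAssignment (bar A)).toEReal := by
  classical
  by_cases hW : maxAssignment (bar A) = ⊥
  · have ha := isLift_monomialLift hK A (c := fun _ _ => 1) fun _ _ => one_ne_zero
    exact ⟨_, ha, hasVal_iff.mpr ⟨ha.valLE_vol, fun s hs => by simp [hW] at hs⟩⟩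
  obtain ⟨g, hg⟩ := exists_sum_eq_maxAssignment _ hW
  set W := maxAssignment (bar A)
  let F : ℕ := Fintype.card (Equiv.Perm (Fin (d + 1)))
  have hF : 0 < F := Fintype.card_pos
  -- Every non-identity term is at most 1/N of the diagonal one, and there are fewer than F of them,
  -- so together they cancel at most half of it.
  let N : ℕ := 2 * F
  have hN : 1 ≤ N := by omega
  let c : Fin d → Fin m → ℕ := fun i j => if j = g i.succ then N else 1
  have hcN : ∀ i j, c i j ≤ N := fun i j => by simp only [c]; split_ifs <;> omega
  have ha := isLift_monomialLift hK A (c := c) fun i j => by simp only [c]; split_ifs <;> omega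
  refine ⟨_, ha, hasVal_iff.mpr ⟨ha.valLE_vol, valGE_vol_of_det g ?_⟩⟩
  -- A non-identity permutation moves some row other than the top one and so loses at least one
  -- factor N.
  have hc : ∀ σ : Equiv.Perm (Fin (d + 1)), σ ≠ 1 →
      N * ∏ i : Fin d, c i (g (σ i.succ)) ≤ N ^ d := by
    intro σ hσ
    obtain ⟨i, hi⟩ : ∃ i : Fin d, σ i.succ ≠ i.succ := by
      by_contra! hall
      apply hσ
      have h0 : σ 0 = 0 := by
        obtain ⟨k, hk⟩ := σ.surjective 0
        rcases Fin.eq_zero_or_eq_succ k with rfl | ⟨l, rfl⟩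
        · exact hk
        · rw [hall] at hk
          exact absurd hk (Fin.succ_ne_zero l)
      ext k
      rcases Fin.eq_zero_or_eq_succ k with rfl | ⟨l, rfl⟩ <;> simp [h0, hall]
    have hci : c i (g (σ i.succ)) = 1 := if_neg fun h => hi (g.injective h)
    have hpow : N ^ d = N * ∏ _k ∈ Finset.univ.erase i, N := by
      rw [Finset.mul_prod_erase _ (fun _ => N) (Finset.mem_univ i)]
      simp
    rw [hpow, ← Finset.mul_prod_erase _ _ (Finset.mem_univ i), hci, one_mul]
    exact Nat.mul_le_mul_left _ (Finset.prod_le_prod' fun k _ => hcN _ _)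
  have hpos : (N : ℝ) ^ d / 2 ≠ 0 := by positivity
  refine ((hasVal_iff.mp (hasVal_tropPow W)).2.const_mul hpos).of_le_abs ?_
  filter_upwards [eventually_ge_atTop 1] with t ht
  have ht0 : 0 < t := by linarith
  have hT : 0 ≤ tropPow W t := tropPow_nonneg W ht0
  let Q : Equiv.Perm (Fin (d + 1)) → ℝ := fun σ =>
    ((Equiv.Perm.sign σ : ℤ) : ℝ) * ∏ i, homogenizeAt (monomialLift A c) t i (g (σ i))
  have hdet : ((homogenizeAt (monomialLift A c) t).submatrix id g).det =
      Q 1 + ∑ σ ∈ Finset.univ.erase 1, Q σ := by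
    rw [det_submatrix_eq_sum, Finset.add_sum_erase _ _ (Finset.mem_univ 1)]
  have hQ1 : Q 1 = (N : ℝ) ^ d * tropPow W t := by
    have := prod_homogenizeAt_monomialLift A c g ht0
    rw [hg] at this
    simp [Q, this, c]
  have hQ : ∀ σ ∈ Finset.univ.erase (1 : Equiv.Perm (Fin (d + 1))),
      |Q σ| ≤ (N : ℝ) ^ d * tropPow W t / N := by
    intro σ hσ
    have hNr : (0 : ℝ) < N := by exact_mod_cast hN
    have h1 : (N : ℝ) * ∏ i : Fin d, (c i (g (σ i.succ)) : ℝ) ≤ (N : ℝ) ^ d := by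
      exact_mod_cast hc σ (Finset.ne_of_mem_erase hσ)
    have h2 : tropPow (∑ i, bar A i (g (σ i))) t ≤ tropPow W t :=
      tropPow_le (sum_le_maxAssignment (bar A) (σ.toEmbedding.trans g)) ht
    have h3 := tropPow_nonneg (∑ i, bar A i (g (σ i))) ht0
    have h4 : (0 : ℝ) ≤ ∏ i : Fin d, (c i (g (σ i.succ)) : ℝ) :=
      Finset.prod_nonneg fun i _ => Nat.cast_nonneg _
    rw [abs_sign_mul, prod_homogenizeAt_monomialLift A c (fun i => g (σ i)) ht0,
      abs_of_nonneg (mul_nonneg h4 h3), le_div_iff₀ hNr]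
    calc _ = (N * ∏ i : Fin d, (c i (g (σ i.succ)) : ℝ)) *
          tropPow (∑ i, bar A i (g (σ i))) t := by ring
      _ ≤ _ := by gcongr
  have hsum : |∑ σ ∈ Finset.univ.erase 1, Q σ| ≤ (N : ℝ) ^ d * tropPow W t / 2 := by
    have hFr : (0 : ℝ) < F := by exact_mod_cast hF
    calc |∑ σ ∈ Finset.univ.erase 1, Q σ| ≤ ∑ σ ∈ Finset.univ.erase 1, |Q σ| :=
          Finset.abs_sum_le_sum_abs _ _
      _ ≤ (Finset.univ.erase (1 : Equiv.Perm (Fin (d + 1)))).card •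
          ((N : ℝ) ^ d * tropPow W t / N) := Finset.sum_le_card_nsmul _ _ _ hQ
      _ ≤ F • ((N : ℝ) ^ d * tropPow W t / N) :=
          nsmul_le_nsmul_left (by positivity) (Finset.card_le_univ _)
      _ = (N : ℝ) ^ d * tropPow W t / 2 := by
          have : (N : ℝ) = 2 * F := by simp [N]
          rw [nsmul_eq_mul, this]
          field_simp
  have htri := abs_sub_abs_le_abs_add (Q 1) (∑ σ ∈ Finset.univ.erase 1, Q σ)
  have hQ1n : 0 ≤ (N : ℝ) ^ d * tropPow W t := by positivity
  rw [hdet, abs_of_nonneg (by positivity)]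
  rw [hQ1, abs_of_nonneg hQ1n] at htri
  rw [hQ1]
  linarith

/-! ### Evaluation of the dequantized volumes -/

theorem qvolPlus_eq {K : Subring RealGerm} (hK : ∀ r : ℝ, germ (fun t => t ^ r) ∈ K)
    {d m : ℕ} (A : Matrix (Fin d) (Fin m) Trop) :
    qvolPlus K A = (maxAssignment (bar A)).toEReal := by
  refine le_antisymm (sSup_le ?_) (le_sSup (exists_isLift_hasVal_vol hK A))
  rintro v ⟨a, ha, hv⟩
  exact (hasVal_iff.mp hv).2.le_of_valLE ha.valLE_vol

theorem qvolMinus_eq {K : Subring RealGerm} (hK : ∀ r : ℝ, germ (fun t => t ^ r) ∈ K)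
    {d m : ℕ} {A : Matrix (Fin d) (Fin m) Trop} (hA : SignGeneric (bar A)) :
    qvolMinus K A = (maxAssignment (bar A)).toEReal := by
  refine le_antisymm (sInf_le (exists_isLift_hasVal_vol hK A)) (le_sInf ?_)
  rintro v ⟨a, ha, hv⟩
  exact (ha.valGE_vol hA).le_of_valLE (hasVal_iff.mp hv).1

end DequantizedVolume

open DequantizedVolume in
theorem mainTheorem5 (L : FirstOrder.Language.{u, v}) [L.Structure ℝ]
    (hL : IsOMinimal L) (hpb : IsPolynomiallyBounded L)
    (K : Subring RealGerm) (hK : IsBaseField L K)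
    (d m p : ℕ) (A : Matrix (Fin d) (Fin m) Trop) (B : Matrix (Fin d) (Fin p) Trop) :
    ((SignGeneric (bar A) ∨ (SignGeneric A ∧ p ≠ d)) → atconv A ⊆ atconv B →
        qvolPlus K A ≤ qvolPlus K B) ∧
      (SignGeneric (bar A) → SignGeneric (bar B) → atconv A = atconv B →
        ∃ q : Trop, IsQvol K A q ∧ IsQvol K B q) := by
  have hr := hK.rpow_mem
  refine ⟨fun h hAB => ?_, fun hA hB hAB => ⟨maxAssignment (bar A), ?_, ?_⟩⟩
  · rw [qvolPlus_eq hr, qvolPlus_eq hr]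
    exact Trop.toEReal_mono (maxAssignment_bar_le h hAB)
  · exact ⟨qvolPlus_eq hr A, qvolMinus_eq hr hA⟩
  · rw [le_antisymm (maxAssignment_bar_le (Or.inl hA) hAB.le)
      (maxAssignment_bar_le (Or.inl hB) hAB.ge)]
    exact ⟨qvolPlus_eq hr B, qvolMinus_eq hr hB⟩
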